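/- There is an absolute constant $C$ such that for every $p\in\mathbb N$ there are constants $B,c$ (depending only on $p$) for which the following holds for all integers $n\ge 2$, $k\ge 1$ and $L\ge 1$ (so $k$ and $L$ may depend on $n$). There is a randomized streaming algorithm $\mathcal A$ for insertion-only streams of edges on the vertex set $[n]$, given in advance an upper bound $L$ on the maximum degree of the streamed graph, whose working memory and random bits together take at most $$B\, n\, L^{1/k} (\log n)^c = \widetilde O(nL^{1/k})$$ bits, and which is adversarially robust in the following sense. Let an adaptive adversary choose the stream token by token, each token being an arbitrary function of all previous outputs of $\mathcal A$, where $\mathcal A$ outputs a vertex coloring at the start and after every token. Then against every such adversary, with probability at least $1-n^{-p}$ over the random bits of $\mathcal A$, at every point in time up to which the stream consists of distinct edges and describes a graph of maximum degree at most $L$, the output is a proper coloring of the current graph with colors from a palette of $C\cdot\max(\Delta,1)^k$ colors, where $\Delta$ is the maximum degree of the current graph. Here an algorithm with $s$ bits of working memory and $r$ random bits consists of an initialization map $\{0,1\}^r\to\{0,1\}^s$, an update map taking the current memory state, the token and the random string to the next memory state, and a query map taking the current memory state and the random string to an output; the random string is uniform in $\{0,1\}^r$ and is drawn once. (In particular,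 $k=2$ gives $O(\Delta^2)$ colors in $\widetilde O(n\sqrt L)$ space.) -/

import Mathlib

/-- A (non-uniform) one-pass streaming algorithm over the token universe `U` with outputs in `Z`,
running in `s` bits of space and using `r` random bits. -/
structure StreamAlg (U Z : Type) (s r : ℕ) where
  init : (Fin r → Bool) → (Fin s → Bool)
  process : (Fin s → Bool) → U → (Fin r → Bool) → (Fin s → Bool)
  query : (Fin s → Bool) → (Fin r → Bool) → Z

namespace StreamAlg

variable {U Z : Type} {s r : ℕ}

/-- The situation after `i` rounds of the game between the algorithm `A` with random string `R` and
the adaptive adversary `next`: the current state `w_i`, the stream `[x_1, …, x_i]` inserted so far,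
and the list `[z_0, …, z_i]` of all outputs given so far. In each round the adversary's token is
`x_{i+1} = next [z_0, …, z_i]`. -/
def game (A : StreamAlg U Z s r) (next : List Z → U) (R : Fin r → Bool) :
    ℕ → (Fin s → Bool) × List U × List Z
  | 0 => (A.init R, [], [A.query (A.init R) R])
  | i + 1 =>
    let w := (A.game next R i).1
    let xs := (A.game next R i).2.1
    let zs := (A.game next R i).2.2
    let x := next zs
    let w' := A.process w x R
    (w', xs ++ [x], zs ++ [A.query w' R])

/-- The stream `[x_1, …, x_i]` produced in the first `i` rounds of the game. -/
def stream (A : StreamAlg U Z s r) (next : List Z → U) (R : Fin r → Bool) (i : ℕ) : List U :=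
  (A.game next R i).2.1

/-- The output `z_i` of the algorithm after `i` rounds of the game. -/
def output (A : StreamAlg U Z s r) (next : List Z → U) (R : Fin r → Bool) (i : ℕ) : Z :=
  A.query (A.game next R i).1 R

end StreamAlg

/-- The probability of an event over a uniformly random string of `r` bits. -/
noncomputable def bitProb {r : ℕ} (E : (Fin r → Bool) → Prop) : ℝ :=
  (Nat.card {R : Fin r → Bool // E R} : ℝ) / 2 ^ r

/-- `A` is a `δ`-error adversarially robust algorithm for the streaming problem `f` on streams of
length at most `m`: against every adaptive adversary, with probability at least `1 - δ` all the
outputs `z_0, …, z_m` are valid for the respective prefixes of the stream. -/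
def StreamAlg.IsRobust {U Z : Type} {s r : ℕ} (A : StreamAlg U Z s r) (f : List U → Z → Prop)
    (m : ℕ) (δ : ℝ) : Prop :=
  ∀ next : List Z → U,
    1 - δ ≤ bitProb fun R => ∀ i ≤ m, f (A.stream next R i) (A.output next R i)

/-- Tokens of an insertion-only graph stream: (loopless) edges on the vertex set `Fin n`. -/
abbrev EdgeToken (n : ℕ) : Type := {e : Sym2 (Fin n) // ¬ e.IsDiag}

/-- The graph described by an insertion-only stream. -/
def streamGraph {n : ℕ} (σ : List (EdgeToken n)) : SimpleGraph (Fin n) :=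
  SimpleGraph.fromEdgeSet {e | ∃ x ∈ σ, x.val = e}

open Classical in
/-- The maximum degree of the graph described by an insertion-only stream. -/
noncomputable def streamMaxDegree {n : ℕ} (σ : List (EdgeToken n)) : ℕ :=
  (streamGraph σ).maxDegree

/-- The streaming problem of maintaining a proper coloring of the current graph with `K Δ` colors,
`Δ` being the maximum degree of the current graph, under the promise that the stream lists distinct
edges and that the maximum degree does not exceed `L`. (Once the promise is broken, every output is
accepted.) The palette of `K` colors is `{0, …, K - 1}`. -/
def ColoringProblem (n L : ℕ) (K : ℕ → ℕ) (σ : List (EdgeToken n)) (z : Fin n → ℕ) : Prop :=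
  σ.Nodup → streamMaxDegree σ ≤ L →
    (∀ v, z v < K (streamMaxDegree σ)) ∧
    ∀ u v, (streamGraph σ).Adj u v → z u ≠ z v

/-! ### Degrees, lengths and greedy colorings of stream graphs. -/

section Graph

/-! The stream is cut into epochs of `P = n * b` tokens. The edges of the current epoch are buffered
in full. Each epoch `e` has its own `κ` independent hash functions with range `R e`, and for each of
these a store collects the monochromatic edges among the first `e * P` tokens. The output in epoch
`e` pairs the hash value of a vertex with its color in a greedy coloring of buffer and store: an
edge outside both is already separated by the hash.

Robustness comes from fresh randomness: the hash functions of epoch `e` do not affect any output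
before that epoch, so the prefix of length `e * P` is independent of them
(`isRobust_of_fresh_epochs`). For a fixed prefix, universality and Markov's inequality let one store
overflow with probability at most 1/2, hence all `κ` with probability at most `2 ^ (-κ)`
(`EpochParams.pow_mul_card_bad_le`). A union bound over the epochs finishes this part. If no such
failure occurs, correctness is deterministic (`EpochParams.coloring_of_not_bad`).

In epoch `e` distinct edges force `e * b ≤ Δ`, so a range `R e` of order `(e * b) ^ a` with `a + 1 ≤
k` costs only `O(Δ ^ k)` colors. The stores for epoch `e` need about `e * n * b / R e` edges. The
choices `(a, b) = (0, L)`, `(1, √L)`, `(2, 1)` for `k = 1`, `k = 2`, `k ≥ 3` make the sum over `e`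
at most `n * b` up to logarithms; for `a = 2` it is harmonic. -/

open Classical in
theorem SimpleGraph.exists_coloring_le_maxDegree {V : Type*} [Fintype V] (G : SimpleGraph V) :
    ∃ g : V → ℕ, (∀ v, g v ≤ G.maxDegree) ∧ ∀ u v, G.Adj u v → g u ≠ g v := by
  suffices H : ∀ W : Finset V, ∃ g : V → ℕ, (∀ v, g v ≤ G.maxDegree) ∧
      ∀ u ∈ W, ∀ v ∈ W, G.Adj u v → g u ≠ g v by
    obtain ⟨g, h1, h2⟩ := H Finset.univ
    exact ⟨g, h1, fun u v => h2 u (Finset.mem_univ _) v (Finset.mem_univ _)⟩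
  intro W
  induction W using Finset.induction_on with
  | empty => exact ⟨fun _ => 0, fun _ => Nat.zero_le _, by simp⟩
  | insert a W ha ih =>
    obtain ⟨g, h1, h2⟩ := ih
    obtain ⟨x, hx, hxn⟩ : ∃ x ∈ Finset.range (G.maxDegree + 1),
        x ∉ (G.neighborFinset a).image g := by
      apply Finset.exists_mem_notMem_of_card_lt_card
      calc ((G.neighborFinset a).image g).card ≤ (G.neighborFinset a).card :=
            Finset.card_image_le
        _ = G.degree a := G.card_neighborFinset_eq_degree a
        _ ≤ G.maxDegree := G.degree_le_maxDegree a
        _ < _ := by simp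
    have hx' : ∀ v, G.Adj a v → g v ≠ x := by
      intro v hv h
      exact hxn (Finset.mem_image.2 ⟨v, by simpa using hv, h⟩)
    refine ⟨Function.update g a x, fun v => ?_, fun u hu v hv huv => ?_⟩
    · by_cases h : v = a
      · subst h
        simpa [Nat.lt_succ_iff] using hx
      · simpa [h] using h1 v
    · have hne := huv.ne
      by_cases hua : u = a
      · subst hua
        simpa [hne.symm] using (hx' v huv).symm
      · by_cases hva : v = a
        · subst hva
          simpa [hne] using hx' u huv.symm
        · simp only [Function.update_of_ne hua, Function.update_of_ne hva]
          exact h2 u (Finset.mem_of_mem_insert_of_ne hu hua) v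
            (Finset.mem_of_mem_insert_of_ne hv hva) huv

variable {n : ℕ}

theorem streamGraph_adj {σ : List (EdgeToken n)} {u v : Fin n} :
    (streamGraph σ).Adj u v ↔ ∃ x ∈ σ, x.val = s(u, v) := by
  simp only [streamGraph, SimpleGraph.fromEdgeSet_adj, Set.mem_ofPred_eq, and_iff_left_iff_imp]
  rintro ⟨x, -, hx⟩ rfl
  exact x.2 (by simp [hx])

theorem streamGraph_mono {σ τ : List (EdgeToken n)} (h : σ ⊆ τ) :
    streamGraph σ ≤ streamGraph τ := by
  intro u v
  simp only [streamGraph_adj]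
  rintro ⟨x, hx, hxe⟩
  exact ⟨x, h hx, hxe⟩

theorem streamMaxDegree_mono {σ τ : List (EdgeToken n)} (h : σ ⊆ τ) :
    streamMaxDegree σ ≤ streamMaxDegree τ := by
  classical
  unfold streamMaxDegree
  exact SimpleGraph.maxDegree_mono (streamGraph_mono h)

theorem streamMaxDegree_le (hn : 0 < n) (σ : List (EdgeToken n)) : streamMaxDegree σ ≤ n := by
  classical
  have : Nonempty (Fin n) := ⟨⟨0, hn⟩⟩
  have := (streamGraph σ).maxDegree_lt_card_verts
  rw [Fintype.card_fin] at this
  unfold streamMaxDegree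
  convert this.le

/-- The handshake lemma. It turns a position in the stream into a lower bound on the current maximum
degree, which is what lets the hash range grow with the epoch. -/
theorem two_mul_length_le {σ : List (EdgeToken n)} (h : σ.Nodup) :
    2 * σ.length ≤ n * streamMaxDegree σ := by
  classical
  have h1 := (streamGraph σ).sum_degrees_eq_twice_card_edges
  have h2 : (streamGraph σ).edgeFinset = σ.toFinset.map (Function.Embedding.subtype _) := by
    ext e
    induction e with
    | h u v =>
      simp [streamGraph_adj]
  rw [h2, Finset.card_map, List.toFinset_card_of_nodup h] at h1
  rw [← h1]
  calc _ ≤ ∑ _v : Fin n, streamMaxDegree σ := Finset.sum_le_sum fun v _ => by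
        unfold streamMaxDegree
        convert (streamGraph σ).degree_le_maxDegree v
    _ = _ := by simp

/-- Degrees never exceed `n`, so the promise may be capped there; afterwards logarithms of the
degree bound are at most logarithms of `n`. -/
theorem ColoringProblem.of_min {L : ℕ} (hn : 0 < n) {K : ℕ → ℕ} {σ : List (EdgeToken n)}
    {z : Fin n → ℕ} (h : ColoringProblem n (min L n) K σ z) : ColoringProblem n L K σ z :=
  fun h1 h2 => h h1 (le_min h2 (streamMaxDegree_le hn σ))

end Graph

/-! ### A universal hash family over `ZMod 2`. -/

section Hash

open Matrix

/-- Flipping a coordinate where `d` is nonzero changes the dot product, so it moves the solution set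
injectively into its complement. -/
theorem two_mul_card_dotProduct_eq_zero_le {ι : Type*} [Fintype ι] [DecidableEq ι]
    {d : ι → ZMod 2} (hd : d ≠ 0) :
    2 * (Finset.univ.filter fun m : ι → ZMod 2 => m ⬝ᵥ d = 0).card ≤
      Fintype.card (ι → ZMod 2) := by
  obtain ⟨j, hj⟩ := Function.ne_iff.1 hd
  have hinj : Function.Injective fun m : ι → ZMod 2 => m + Pi.single j 1 := add_left_injective _
  have hdisj : Disjoint (Finset.univ.filter fun m : ι → ZMod 2 => m ⬝ᵥ d = 0)
      ((Finset.univ.filter fun m : ι → ZMod 2 => m ⬝ᵥ d = 0).image (· + Pi.single j 1)) := by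
    rw [Finset.disjoint_left]
    intro m hm hm'
    obtain ⟨m', h', rfl⟩ := Finset.mem_image.1 hm'
    simp only [Finset.mem_filter, Finset.mem_univ, true_and, add_dotProduct, single_dotProduct,
      one_mul] at hm h'
    rw [h', zero_add] at hm
    exact hj hm
  calc _ = ((Finset.univ.filter fun m : ι → ZMod 2 => m ⬝ᵥ d = 0) ∪
        (Finset.univ.filter fun m : ι → ZMod 2 => m ⬝ᵥ d = 0).image (· + Pi.single j 1)).card := by
        rw [Finset.card_union_of_disjoint hdisj, Finset.card_image_of_injective _ hinj, two_mul]
    _ ≤ _ := Finset.card_le_univ _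

/-- Random linear maps over `ZMod 2` form a universal hash family. -/
theorem exists_universal_hash {V : Type*} [Fintype V] {t w ρ : ℕ} (hV : Fintype.card V ≤ 2 ^ t)
    (hρ : ρ ≤ w) :
    ∃ hash : (Fin w → Fin t → ZMod 2) → V → Fin (2 ^ ρ), ∀ u v, u ≠ v →
      2 ^ ρ * (Finset.univ.filter fun M => hash M u = hash M v).card ≤
        Fintype.card (Fin w → Fin t → ZMod 2) := by
  obtain ⟨code⟩ : Nonempty (V ↪ (Fin t → ZMod 2)) :=
    Function.Embedding.nonempty_of_card_le (by simpa [ZMod.card] using hV)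
  let φ : (Fin ρ → ZMod 2) ≃ Fin (2 ^ ρ) := Fintype.equivFinOfCardEq (by simp [ZMod.card])
  refine ⟨fun M v => φ fun i => M (Fin.castLE hρ i) ⬝ᵥ code v, fun u v huv => ?_⟩
  have hd : code u - code v ≠ 0 := sub_ne_zero.2 fun h => huv (code.injective h)
  set S := Finset.univ.filter fun m : Fin t → ZMod 2 => m ⬝ᵥ (code u - code v) = 0 with hS
  have hsub : (Finset.univ.filter fun M : Fin w → Fin t → ZMod 2 =>
      (φ fun i => M (Fin.castLE hρ i) ⬝ᵥ code u) = φ fun i => M (Fin.castLE hρ i) ⬝ᵥ code v) ⊆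
      Fintype.piFinset fun i : Fin w => if i.val < ρ then S else Finset.univ := by
    intro M hM
    rw [Finset.mem_filter] at hM
    rw [Fintype.mem_piFinset]
    intro i
    split_ifs with hi
    · have := congrFun (φ.injective hM.2) ⟨i, hi⟩
      simp only [hS, Finset.mem_filter, Finset.mem_univ, true_and, dotProduct_sub]
      exact sub_eq_zero.2 this
    · exact Finset.mem_univ _
  -- Only the first `ρ` of the `w` rows are used, so that epochs with different ranges share one key
  -- type. Spreading `2 ^ ρ` over the rows allows a comparison factor by factor.
  have hpow : 2 ^ ρ = ∏ i : Fin w, if i.val < ρ then 2 else 1 := by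
    rw [Finset.prod_ite, Finset.prod_const, Finset.prod_const_one, mul_one]
    congr 1
    rw [← Fintype.card_subtype, Fintype.card_congr (β := Fin ρ)]
    · simp
    · exact ⟨fun i => ⟨i.1, i.2⟩, fun i => ⟨Fin.castLE hρ i, i.2⟩, fun _ => rfl, fun _ => rfl⟩
  calc _ ≤ 2 ^ ρ * _ := Nat.mul_le_mul_left _ (Finset.card_le_card hsub)
    _ = ∏ i : Fin w, (if i.val < ρ then 2 else 1) *
        (if i.val < ρ then S else Finset.univ).card := by
        rw [Fintype.card_piFinset, hpow, Finset.prod_mul_distrib]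
    _ ≤ ∏ _i : Fin w, Fintype.card (Fin t → ZMod 2) := by
        refine Finset.prod_le_prod' fun i _ => ?_
        split_ifs
        · exact two_mul_card_dotProduct_eq_zero_le hd
        · simp
    _ = _ := by rw [Fintype.card_fun]; simp

end Hash

/-! ### Markov's inequality, independence and conditioning as counting statements. -/

section Counting

open Finset

/-- Double counting of the pairs `(h, y)` with `r h y`: their average number per `h` is at most `#A
/ R`, which is below `N / 2`. -/
theorem two_mul_card_filter_le_of_markov {H Y : Type*} [Fintype H] (A : Finset Y)
    (r : H → Y → Prop) [∀ h y, Decidable (r h y)] {R N : ℕ}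
    (hr : ∀ y ∈ A, R * #{h | r h y} ≤ Fintype.card H) (hN : 2 * #A < R * N) :
    2 * #{h : H | N ≤ #{y ∈ A | r h y}} ≤ Fintype.card H := by
  have h1 : N * #{h : H | N ≤ #{y ∈ A | r h y}} ≤ ∑ y ∈ A, #{h | r h y} := by
    calc _ = ∑ h : H with N ≤ #{y ∈ A | r h y}, N := by rw [sum_const, smul_eq_mul, mul_comm]
      _ ≤ ∑ h : H with N ≤ #{y ∈ A | r h y}, #{y ∈ A | r h y} :=
        sum_le_sum fun h hh => (mem_filter.1 hh).2
      _ ≤ ∑ h : H, #{y ∈ A | r h y} := sum_le_sum_of_subset (filter_subset _ _)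
      _ = _ := sum_card_bipartiteAbove_eq_sum_card_bipartiteBelow r
  have h2 : R * ∑ y ∈ A, #{h | r h y} ≤ #A * Fintype.card H := by
    rw [mul_sum, ← smul_eq_mul, ← sum_const]
    exact sum_le_sum hr
  have h3 := Nat.mul_le_mul_left R h1
  refine le_of_mul_le_mul_left (a := R * N) ?_ ((Nat.zero_le _).trans_lt hN)
  nlinarith [Nat.zero_le (Fintype.card H)]

theorem pow_mul_card_filter_forall_le {H : Type*} [Fintype H] (P : H → Prop) [DecidablePred P]
    (hP : 2 * #{h : H | P h} ≤ Fintype.card H) (κ : ℕ) :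
    2 ^ κ * #{x : Fin κ → H | ∀ c, P (x c)} ≤ Fintype.card (Fin κ → H) := by
  have h : ({x : Fin κ → H | ∀ c, P (x c)} : Finset _) =
      Fintype.piFinset fun _ => ({h : H | P h} : Finset H) := by
    ext x; simp
  rw [h, Fintype.card_piFinset, prod_const, card_univ, Fintype.card_fin, ← mul_pow,
    Fintype.card_fun, Fintype.card_fin]
  exact Nat.pow_le_pow_left hP κ

/-- If the event `P ω` about a fresh coordinate does not depend on that coordinate of `ω`, then its
probability is bounded by the maximum of the conditional probabilities. -/
theorem mul_card_filter_coord_le {ι X : Type*} [Fintype ι] [DecidableEq ι] [Fintype X] [Nonempty X]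
    (e : ι) (P : (ι → X) → X → Prop) [∀ ω, DecidablePred (P ω)]
    (hP : ∀ ω x x', P (Function.update ω e x') x ↔ P ω x) {K : ℕ}
    (hK : ∀ ω, K * #{x | P ω x} ≤ Fintype.card X) :
    K * #{ω : ι → X | P ω (ω e)} ≤ Fintype.card (ι → X) := by
  have h1 : #{ω : ι → X | P ω (ω e)} * Fintype.card X =
      #{y : (ι → X) × X | P y.1 y.2} := by
    rw [← card_univ (α := X), ← card_product]
    -- Exchanging the coordinate `e` with the extra sample is an involution, and `hP` says that `P`
    -- does not notice the change.
    refine card_bij' (fun y _ => (Function.update y.1 e y.2, y.1 e))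
      (fun y _ => (Function.update y.1 e y.2, y.1 e)) ?_ ?_ ?_ ?_
    · simp [hP]
    · simp [hP]
    · simp
    · simp
  have h2 : #{y : (ι → X) × X | P y.1 y.2} = ∑ ω, #{x | P ω x} := by
    simp only [card_filter, Fintype.sum_prod_type]
  refine le_of_mul_le_mul_right (a := Fintype.card X) ?_
    (Fintype.card_pos (α := X))
  rw [mul_assoc, h1, h2, mul_sum, ← card_univ (α := ι → X), ← smul_eq_mul, ← sum_const]
  exact sum_le_sum fun ω _ => hK ω

end Counting

/-! ### The adaptive game and robustness from fresh randomness. -/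

section Game

variable {U Z : Type}

/-- The stream and the list of outputs after some rounds of the game between an adaptive adversary
and an algorithm whose output is the function `out` of the stream. -/
def adaptiveRun (out : List U → Z) (next : List Z → U) : ℕ → List U × List Z
  | 0 => ([], [out []])
  | i + 1 =>
    let p := adaptiveRun out next i
    (p.1 ++ [next p.2], p.2 ++ [out (p.1 ++ [next p.2])])

theorem length_adaptiveRun (out : List U → Z) (next : List Z → U) (i : ℕ) :
    (adaptiveRun out next i).1.length = i := by
  induction i with
  | zero => rfl
  | succ i ih => simp [adaptiveRun, ih]

theorem take_adaptiveRun (out : List U → Z) (next : List Z → U) {i j : ℕ} (h : j ≤ i) :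
    (adaptiveRun out next i).1.take j = (adaptiveRun out next j).1 := by
  induction i, h using Nat.le_induction with
  | base => exact List.take_of_length_le (length_adaptiveRun _ _ _).le
  | succ i hi ih =>
    rw [← ih]
    exact List.take_append_of_le_length (by rwa [length_adaptiveRun])

/-- The `T`-th token is chosen from the outputs on prefixes shorter than `T`, hence the strict
inequality in the hypothesis. -/
theorem adaptiveRun_congr {out out' : List U → Z} (next : List Z → U) {T : ℕ}
    (h : ∀ σ : List U, σ.length < T → out σ = out' σ) :
    (adaptiveRun out next T).1 = (adaptiveRun out' next T).1 := by
  have H : ∀ i < T, adaptiveRun out next i = adaptiveRun out' next i := by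
    intro i
    induction i with
    | zero => intro hi; simp [adaptiveRun, h [] hi]
    | succ i ih =>
      intro hi
      have := ih (by omega)
      simp only [adaptiveRun, this]
      rw [h _ (by simpa [length_adaptiveRun] using hi)]
  cases T with
  | zero => rfl
  | succ T => simp only [adaptiveRun, H T (by omega)]

/-- An algorithm with a finite state space `S` and a finite uniform probability space `Ω` can be
implemented with bit strings. -/
theorem exists_streamAlg {S Ω : Type} [Fintype S] [Fintype Ω] {s r : ℕ}
    (hS : Fintype.card S ≤ 2 ^ s) (hΩ : Fintype.card Ω = 2 ^ r) (start : S)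
    (step : Ω → S → U → S) (query : Ω → S → Z) :
    ∃ (A : StreamAlg U Z s r) (φ : (Fin r → Bool) ≃ Ω), ∀ next R i,
      A.stream next R i =
        (adaptiveRun (fun σ => query (φ R) (σ.foldl (step (φ R)) start)) next i).1 ∧
      A.output next R i = query (φ R) ((A.stream next R i).foldl (step (φ R)) start) := by
  obtain ⟨enc⟩ : Nonempty (S ↪ (Fin s → Bool)) :=
    Function.Embedding.nonempty_of_card_le (by simpa using hS)
  have : Nonempty S := ⟨start⟩
  let dec := Function.invFun enc
  have hdec : ∀ x, dec (enc x) = x := Function.leftInverse_invFun enc.injective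
  let φ : (Fin r → Bool) ≃ Ω := Fintype.equivOfCardEq (by simp [hΩ])
  let A : StreamAlg U Z s r :=
    { init := fun _ => enc start
      process := fun w x R => enc (step (φ R) (dec w) x)
      query := fun w R => query (φ R) (dec w) }
  refine ⟨A, φ, fun next R i => ?_⟩
  have key : A.game next R i = (enc ((A.stream next R i).foldl (step (φ R)) start),
      adaptiveRun (fun σ => query (φ R) (σ.foldl (step (φ R)) start)) next i) := by
    induction i with
    | zero => simp [StreamAlg.game, StreamAlg.stream, adaptiveRun, A, hdec]
    | succ i ih =>
      simp only [StreamAlg.stream] at ih ⊢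
      rw [StreamAlg.game]
      generalize hg : A.game next R i = g at ih ⊢
      obtain ⟨w, xs, zs⟩ := g
      simp only [Prod.mk.injEq] at ih
      obtain ⟨hw, hrun⟩ := ih
      simp only [adaptiveRun, ← hrun, hw, A, hdec, List.foldl_append, List.foldl_cons,
        List.foldl_nil]
  refine ⟨by rw [StreamAlg.stream, key], ?_⟩
  rw [StreamAlg.output, key]
  simp only [A, hdec]

open Classical in
/-- Robustness by fresh randomness: if during epoch `e` the output depends only on the coordinate
`ω e` of the random string, then each of these coordinates is independent of the stream that
precedes its epoch, and a union bound over the epochs applies. -/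
theorem isRobust_of_fresh_epochs {S X : Type} [Fintype S] [Fintype X] [Nonempty X] {s r E : ℕ}
    (hS : Fintype.card S ≤ 2 ^ s) (hΩ : Fintype.card (Fin (E + 1) → X) = 2 ^ r) (start : S)
    (step : (Fin (E + 1) → X) → S → U → S) (query : (Fin (E + 1) → X) → S → Z)
    (f : List U → Z → Prop) (time : Fin (E + 1) → ℕ) (bad : Fin (E + 1) → List U → X → Prop)
    {κ : ℕ}
    (hfresh : ∀ e (ω : Fin (E + 1) → X) x (σ : List U), σ.length < time e →
      query (Function.update ω e x) (σ.foldl (step (Function.update ω e x)) start) =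
        query ω (σ.foldl (step ω) start))
    (hbad : ∀ e σ, σ.length = time e →
      2 ^ κ * (Finset.univ.filter fun x => bad e σ x).card ≤ Fintype.card X)
    (hgood : ∀ ω σ, (∀ e, time e ≤ σ.length → ¬ bad e (σ.take (time e)) (ω e)) →
      f σ (query ω (σ.foldl (step ω) start))) :
    ∃ A : StreamAlg U Z s r, ∀ m, A.IsRobust f m ((E + 1 : ℕ) / 2 ^ κ) := by
  obtain ⟨A, φ, hA⟩ := exists_streamAlg hS hΩ start step query
  refine ⟨A, fun m next => ?_⟩
  set out : (Fin (E + 1) → X) → List U → Z := fun ω σ => query ω (σ.foldl (step ω) start)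
    with hout
  set B : Fin (E + 1) → Finset (Fin (E + 1) → X) := fun e =>
    Finset.univ.filter fun ω => bad e (adaptiveRun (out ω) next (time e)).1 (ω e) with hB
  have hBcard : ∀ e, 2 ^ κ * (B e).card ≤ Fintype.card (Fin (E + 1) → X) := by
    intro e
    refine mul_card_filter_coord_le e
      (fun ω x => bad e (adaptiveRun (out ω) next (time e)).1 x) (fun ω x x' => ?_) fun ω => ?_
    · rw [adaptiveRun_congr next fun σ hσ => hfresh e ω x' σ hσ]
    · exact hbad e _ (length_adaptiveRun _ _ _)
  have hunion : 2 ^ κ * (Finset.univ.biUnion B).card ≤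
      (E + 1) * Fintype.card (Fin (E + 1) → X) := by
    calc _ ≤ 2 ^ κ * ∑ e, (B e).card := Nat.mul_le_mul_left _ Finset.card_biUnion_le
      _ = ∑ e, 2 ^ κ * (B e).card := Finset.mul_sum _ _ _
      _ ≤ ∑ _e : Fin (E + 1), Fintype.card (Fin (E + 1) → X) :=
        Finset.sum_le_sum fun e _ => hBcard e
      _ = _ := by simp
  have hcompl : ((Finset.univ.biUnion B)ᶜ).card ≤ Nat.card {R : Fin r → Bool //
      ∀ i ≤ m, f (A.stream next R i) (A.output next R i)} := by
    rw [Nat.card_eq_fintype_card, Fintype.card_subtype,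
      ← Finset.card_map φ.symm.toEmbedding]
    refine Finset.card_le_card fun R hR => ?_
    obtain ⟨ω, hω, rfl⟩ := Finset.mem_map.1 hR
    refine Finset.mem_filter.2 ⟨Finset.mem_univ _, fun i _ => ?_⟩
    obtain ⟨h1, h2⟩ := hA next (φ.symm ω) i
    simp only [Equiv.coe_toEmbedding]
    rw [h2, h1]
    simp only [Equiv.apply_symm_apply]
    refine hgood ω _ fun e he hbe => ?_
    rw [length_adaptiveRun] at he
    rw [take_adaptiveRun _ _ he] at hbe
    exact Finset.mem_compl.1 hω (Finset.mem_biUnion.2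
      ⟨e, Finset.mem_univ _, Finset.mem_filter.2 ⟨Finset.mem_univ _, hbe⟩⟩)
  rw [Finset.card_compl, hΩ] at hcompl
  rw [hΩ] at hunion
  have hcompl' : (2 : ℝ) ^ r ≤ Nat.card {R : Fin r → Bool //
      ∀ i ≤ m, f (A.stream next R i) (A.output next R i)} + (Finset.univ.biUnion B).card := by
    exact_mod_cast Nat.sub_le_iff_le_add.1 hcompl
  have hunion' : (2 : ℝ) ^ κ * (Finset.univ.biUnion B).card ≤ (E + 1 : ℕ) * 2 ^ r := by
    exact_mod_cast hunion
  rw [bitProb, le_div_iff₀ (by positivity), sub_mul, one_mul, sub_le_iff_le_add]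
  refine hcompl'.trans (add_le_add le_rfl ?_)
  rw [div_mul_eq_mul_div, le_div_iff₀ (by positivity), mul_comm]
  exact hunion'

end Game

/-! ### Edge sets of bounded capacity and their encoding. -/

section Store

variable {n : ℕ}

/-- Sets of at most `N` edges. -/
abbrev BoundedEdgeSet (n N : ℕ) : Type := {T : Finset (EdgeToken n) // T.card ≤ N}

open Classical in
/-- Insert an edge unless the capacity is exceeded. -/
noncomputable def BoundedEdgeSet.insert {N : ℕ} (T : BoundedEdgeSet n N) (x : EdgeToken n) :
    BoundedEdgeSet n N :=
  if h : (Insert.insert x T.1).card ≤ N then ⟨Insert.insert x T.1, h⟩ else T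

namespace BoundedEdgeSet

variable {N : ℕ}

/-- The empty edge set. -/
def empty : BoundedEdgeSet n N := ⟨∅, Nat.zero_le _⟩

theorem subset_insert (T : BoundedEdgeSet n N) (x : EdgeToken n) : T.1 ⊆ (T.insert x).1 := by
  classical
  unfold insert
  split_ifs
  · exact Finset.subset_insert _ _
  · exact subset_rfl

theorem insert_subset (T : BoundedEdgeSet n N) (x : EdgeToken n) :
    ∀ y ∈ (T.insert x).1, y = x ∨ y ∈ T.1 := by
  classical
  unfold insert
  split_ifs
  · exact fun y hy => Finset.mem_insert.1 hy
  · exact fun y hy => Or.inr hy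

theorem mem_insert_self (T : BoundedEdgeSet n N) (x : EdgeToken n) (h : T.1.card < N) :
    x ∈ (T.insert x).1 := by
  classical
  unfold insert
  rw [dif_pos ((Finset.card_insert_le _ _).trans h)]
  exact Finset.mem_insert_self _ _

theorem card_insert_le (T : BoundedEdgeSet n N) (x : EdgeToken n) :
    (T.insert x).1.card ≤ T.1.card + 1 := by
  classical
  unfold insert
  split_ifs
  · exact Finset.card_insert_le _ _
  · exact Nat.le_succ _

theorem card_edgeToken_succ_le (hn : 1 ≤ n) : Fintype.card (EdgeToken n) + 1 ≤ n ^ 2 := by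
  rw [Sym2.card_subtype_not_diag, Fintype.card_fin]
  have h1 : n.choose 2 ≤ n ^ 2 - n := by
    rw [Nat.choose_two_right]
    refine (Nat.div_le_self _ _).trans ?_
    rw [Nat.mul_sub, mul_one, sq]
  have h2 : n ≤ n ^ 2 := by nlinarith
  omega

/-- A set is described by `N` slots, each holding an edge or nothing; this leaves at most `n ^ 2`
possibilities per slot. -/
theorem card_le {l : ℕ} (hn : 1 ≤ n) (hl : n ≤ 2 ^ l) :
    Fintype.card (BoundedEdgeSet n N) ≤ 2 ^ (2 * l * N) := by
  classical
  let F : (Fin N → Option (EdgeToken n)) → Finset (EdgeToken n) :=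
    fun g => Finset.univ.filter fun x => ∃ i, g i = some x
  have hF : ∀ T : BoundedEdgeSet n N, ∃ g, F g = T.1 := by
    rintro ⟨T, hT⟩
    refine ⟨fun i => if h : i.1 < T.card then some (T.equivFin.symm ⟨i, h⟩).1 else none, ?_⟩
    ext x
    simp only [F, Finset.mem_filter, Finset.mem_univ, true_and]
    constructor
    · rintro ⟨i, hi⟩
      split_ifs at hi with h
      rw [← Option.some.inj hi]
      exact (T.equivFin.symm ⟨i, h⟩).2
    · intro hx
      refine ⟨⟨T.equivFin ⟨x, hx⟩, (T.equivFin ⟨x, hx⟩).2.trans_le hT⟩, ?_⟩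
      simp
  choose g hg using hF
  have hinj : Function.Injective g := fun T T' h =>
    Subtype.ext (by rw [← hg T, ← hg T', h])
  calc Fintype.card (BoundedEdgeSet n N) ≤ Fintype.card (Fin N → Option (EdgeToken n)) :=
        Fintype.card_le_of_injective g hinj
    _ = (Fintype.card (EdgeToken n) + 1) ^ N := by simp
    _ ≤ (n ^ 2) ^ N := Nat.pow_le_pow_left (card_edgeToken_succ_le hn) N
    _ ≤ ((2 ^ l) ^ 2) ^ N := by gcongr
    _ = _ := by rw [← pow_mul, ← pow_mul]; ring_nf

end BoundedEdgeSet

end Store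

/-! ### The coloring algorithm. -/

/-- The parameters of the coloring algorithm: the length `P` of an epoch, the index `E` of the last
epoch, the number `κ` of independent stores for each epoch, and, for each epoch `e`, the capacity
`N e` of its stores and a hash family with keys in `H` and `R e` values. -/
structure EpochParams (n : ℕ) (H : Type) where
  P : ℕ
  E : ℕ
  κ : ℕ
  N : Fin (E + 1) → ℕ
  R : Fin (E + 1) → ℕ
  hash : (e : Fin (E + 1)) → H → Fin n → Fin (R e)
  P_pos : 0 < P

namespace EpochParams

variable {n : ℕ} {H : Type} (π : EpochParams n H)

/-- The number of tokens up to which the algorithm counts. -/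
def M : ℕ := π.P * (π.E + 1) - 1

/-- The random string: independent hash functions for all epochs. -/
abbrev Rand : Type := Fin (π.E + 1) → Fin π.κ → H

/-- The memory of the coloring algorithm: the number of tokens so far, the edges of the current
epoch, and, for each epoch, the stores of monochromatic edges preceding it. -/
abbrev State : Type :=
  Fin (π.M + 1) × BoundedEdgeSet n π.P × ((e : Fin (π.E + 1)) → Fin π.κ → BoundedEdgeSet n (π.N e))

/-- The edge `x` is monochromatic under the hash function with key `h`. -/
def Mono (e : Fin (π.E + 1)) (h : H) (x : EdgeToken n) : Prop :=
  ∀ u ∈ x.1, ∀ v ∈ x.1, π.hash e h u = π.hash e h v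

/-- The initial state. -/
def start : π.State := (0, BoundedEdgeSet.empty, fun _ _ => BoundedEdgeSet.empty)

open Classical in
/-- The processing of a token. -/
noncomputable def step (ω : π.Rand) (s : π.State) (x : EdgeToken n) : π.State :=
  (⟨min (s.1 + 1) π.M, by omega⟩,
    if π.P ∣ s.1 + 1 then BoundedEdgeSet.empty else s.2.1.insert x,
    fun e c => if s.1.1 < e * π.P ∧ π.Mono e (ω e c) x then (s.2.2 e c).insert x else s.2.2 e c)

/-- The state after a stream. -/
noncomputable def run (ω : π.Rand) (σ : List (EdgeToken n)) : π.State :=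
  σ.foldl (π.step ω) π.start

/-- The epoch after `i` tokens. -/
def epoch (i : ℕ) : Fin (π.E + 1) :=
  ⟨min (i / π.P) π.E, by omega⟩

/-! ### Invariants of the counter, the buffer and the stores. -/

theorem run_append (ω : π.Rand) (σ : List (EdgeToken n)) (x : EdgeToken n) :
    π.run ω (σ ++ [x]) = π.step ω (π.run ω σ) x := by
  simp [run]

theorem run_count (ω : π.Rand) (σ : List (EdgeToken n)) :
    (π.run ω σ).1.1 = min σ.length π.M := by
  induction σ using List.reverseRecOn with
  | nil => simp [run, start]
  | append_singleton σ x ih =>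
    rw [run_append, step, List.length_append, List.length_singleton]
    simp only [ih]
    omega

theorem run_buffer_congr (ω ω' : π.Rand) (σ : List (EdgeToken n)) :
    (π.run ω σ).2.1 = (π.run ω' σ).2.1 := by
  induction σ using List.reverseRecOn with
  | nil => rfl
  | append_singleton σ x ih => simp only [run_append, step, ih, run_count]

theorem run_append_store (ω : π.Rand) (σ : List (EdgeToken n)) (x : EdgeToken n)
    (e : Fin (π.E + 1)) (c : Fin π.κ) :
    (π.run ω (σ ++ [x])).2.2 e c =
      open Classical in if min σ.length π.M < e * π.P ∧ π.Mono e (ω e c) x then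
        ((π.run ω σ).2.2 e c).insert x else (π.run ω σ).2.2 e c := by
  rw [run_append, ← run_count]
  rfl

theorem run_store_congr {ω ω' : π.Rand} {e : Fin (π.E + 1)} (h : ω e = ω' e)
    (σ : List (EdgeToken n)) : (π.run ω σ).2.2 e = (π.run ω' σ).2.2 e := by
  induction σ using List.reverseRecOn with
  | nil => rfl
  | append_singleton σ x ih =>
    funext c
    rw [run_append_store, run_append_store, ih, h]

theorem run_buffer_subset (ω : π.Rand) (σ : List (EdgeToken n)) :
    ∀ y ∈ (π.run ω σ).2.1.1, y ∈ σ := by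
  induction σ using List.reverseRecOn with
  | nil => simp [run, start, BoundedEdgeSet.empty]
  | append_singleton σ x ih =>
    intro y hy
    simp only [run_append, step] at hy
    split_ifs at hy with h
    · simp [BoundedEdgeSet.empty] at hy
    · rcases BoundedEdgeSet.insert_subset _ _ y hy with rfl | hy
      · simp
      · exact List.mem_append_left _ (ih y hy)

theorem run_buffer_card (ω : π.Rand) (σ : List (EdgeToken n)) (hσ : σ.length ≤ π.M) :
    (π.run ω σ).2.1.1.card ≤ σ.length % π.P := by
  induction σ using List.reverseRecOn with
  | nil => simp [run, start, BoundedEdgeSet.empty]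
  | append_singleton σ x ih =>
    rw [List.length_append, List.length_singleton] at hσ ⊢
    simp only [run_append, step, run_count, min_eq_left (show σ.length ≤ π.M by omega)]
    split_ifs with h
    · simp [BoundedEdgeSet.empty]
    · refine (BoundedEdgeSet.card_insert_le _ _).trans ?_
      rw [show (σ.length + 1) % π.P = σ.length % π.P + 1 by
        have h1 := Nat.div_add_mod σ.length π.P
        have h2 := Nat.div_add_mod (σ.length + 1) π.P
        rw [Nat.succ_div_of_not_dvd h] at h2
        omega]
      exact Nat.succ_le_succ (ih (by omega))

/-- The buffer is emptied exactly at multiples of `P` and so never reaches its capacity before an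
insertion: it loses nothing from the current epoch. -/
theorem mem_run_buffer_or (ω : π.Rand) (σ : List (EdgeToken n)) (hσ : σ.length ≤ π.M) :
    ∀ y ∈ σ, y ∈ (π.run ω σ).2.1.1 ∨ y ∈ σ.take (σ.length / π.P * π.P) := by
  induction σ using List.reverseRecOn with
  | nil => simp
  | append_singleton σ x ih =>
    intro y hy
    rw [List.length_append, List.length_singleton] at hσ ⊢
    have hσ' : σ.length ≤ π.M := by omega
    by_cases h : π.P ∣ σ.length + 1
    · right
      rw [Nat.div_mul_cancel h, List.take_of_length_le (by simp)]
      exact hy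
    · simp only [run_append, step, run_count, min_eq_left hσ', if_neg h]
      have hcard : (π.run ω σ).2.1.1.card < π.P :=
        (π.run_buffer_card ω σ hσ').trans_lt (Nat.mod_lt _ π.P_pos)
      rw [Nat.succ_div_of_not_dvd h, List.take_append_of_le_length (Nat.div_mul_le_self _ _)]
      rcases List.mem_append.1 hy with hy | hy
      · exact (ih hσ' y hy).imp_left fun hy => BoundedEdgeSet.subset_insert _ _ hy
      · rw [List.mem_singleton.1 hy]
        exact Or.inl (BoundedEdgeSet.mem_insert_self _ _ hcard)

theorem run_store_subset (ω : π.Rand) (e : Fin (π.E + 1)) (c : Fin π.κ) (σ : List (EdgeToken n))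
    (hσ : σ.length ≤ π.M) :
    ∀ y ∈ ((π.run ω σ).2.2 e c).1, y ∈ σ.take (e * π.P) ∧ π.Mono e (ω e c) y := by
  induction σ using List.reverseRecOn with
  | nil => simp [run, start, BoundedEdgeSet.empty]
  | append_singleton σ x ih =>
    rw [List.length_append, List.length_singleton] at hσ
    have hσ' : σ.length ≤ π.M := by omega
    intro y hy
    have hmono : y ∈ σ.take (e * π.P) → y ∈ (σ ++ [x]).take (e * π.P) := fun h => by
      rw [List.take_append]
      exact List.mem_append_left _ h
    rw [run_append_store, min_eq_left hσ'] at hy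
    split_ifs at hy with h
    · rcases BoundedEdgeSet.insert_subset _ _ y hy with rfl | hy
      · refine ⟨?_, h.2⟩
        rw [List.take_of_length_le (by simpa using h.1)]
        simp
      · exact (ih hσ' y hy).imp_left hmono
    · exact (ih hσ' y hy).imp_left hmono

/-- Stores only grow, so one that is below capacity now was so at every earlier time and never
refused an edge. -/
theorem mem_run_store (ω : π.Rand) (e : Fin (π.E + 1)) (c : Fin π.κ) (σ : List (EdgeToken n))
    (hσ : σ.length ≤ π.M) (hc : ((π.run ω σ).2.2 e c).1.card < π.N e) :
    ∀ y ∈ σ.take (e * π.P), π.Mono e (ω e c) y → y ∈ ((π.run ω σ).2.2 e c).1 := by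
  induction σ using List.reverseRecOn with
  | nil => simp
  | append_singleton σ x ih =>
    rw [List.length_append, List.length_singleton] at hσ
    have hσ' : σ.length ≤ π.M := by omega
    rw [run_append_store, min_eq_left hσ'] at hc ⊢
    intro y hy hm
    rw [List.take_append] at hy
    split_ifs at hc ⊢ with h
    · have hc' := (Finset.card_le_card (BoundedEdgeSet.subset_insert _ x)).trans_lt hc
      rcases List.mem_append.1 hy with hy | hy
      · exact BoundedEdgeSet.subset_insert _ _ (ih hσ' hc' y hy hm)
      · rw [List.mem_singleton.1 (List.mem_of_mem_take hy)]
        exact BoundedEdgeSet.mem_insert_self _ _ hc'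
    · rcases List.mem_append.1 hy with hy | hy
      · exact ih hσ' hc y hy hm
      · have hyx := List.mem_singleton.1 (List.mem_of_mem_take hy)
        subst hyx
        -- A monochromatic token is skipped only from position `e * P` on, where it contributes
        -- nothing to the prefix.
        refine absurd ⟨?_, hm⟩ h
        by_contra hlt
        rw [Nat.sub_eq_zero_of_le (not_lt.1 hlt)] at hy
        simp at hy

/-! ### The output, its failure probability and its correctness. -/

/-- A proper coloring of the graph with the edge set `T`. -/
noncomputable def greedy (T : Finset (EdgeToken n)) : Fin n → ℕ :=
  open Classical in (streamGraph T.toList).exists_coloring_le_maxDegree.choose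

theorem greedy_le (T : Finset (EdgeToken n)) (v : Fin n) :
    greedy T v ≤ streamMaxDegree T.toList := by
  classical
  exact (streamGraph T.toList).exists_coloring_le_maxDegree.choose_spec.1 v

theorem greedy_ne (T : Finset (EdgeToken n)) {u v : Fin n} (h : (streamGraph T.toList).Adj u v) :
    greedy T u ≠ greedy T v := by
  classical
  exact (streamGraph T.toList).exists_coloring_le_maxDegree.choose_spec.2 u v h

open Classical in
/-- The coloring computed during epoch `e` from the hash functions, the buffer and the stores. -/
noncomputable def color (e : Fin (π.E + 1)) (x : Fin π.κ → H) (T₀ : Finset (EdgeToken n))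
    (T : Fin π.κ → BoundedEdgeSet n (π.N e)) (v : Fin n) : ℕ :=
  if h : ∃ c, (T c).1.card < π.N e then
    π.hash e (x h.choose) v + π.R e * greedy (T₀ ∪ (T h.choose).1) v
  else 0

/-- The output of the algorithm. -/
noncomputable def query (ω : π.Rand) (s : π.State) : Fin n → ℕ :=
  π.color (π.epoch s.1) (ω (π.epoch s.1)) s.2.1.1 (s.2.2 (π.epoch s.1))

open Classical in
/-- All stores for epoch `e` overflow. -/
def Bad (e : Fin (π.E + 1)) (σ : List (EdgeToken n)) (x : Fin π.κ → H) : Prop :=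
  ∀ c, π.N e ≤ (σ.toFinset.filter fun y => π.Mono e (x c) y).card

theorem query_run (ω : π.Rand) (σ : List (EdgeToken n)) {i : ℕ} (hi : min σ.length π.M = i) :
    π.query ω (π.run ω σ) = π.color (π.epoch i) (ω (π.epoch i)) (π.run ω σ).2.1.1
      ((π.run ω σ).2.2 (π.epoch i)) := by
  rw [← run_count π ω] at hi
  subst hi
  rfl

theorem query_run_congr {ω ω' : π.Rand} {σ : List (EdgeToken n)}
    (h : ω (π.epoch (min σ.length π.M)) = ω' (π.epoch (min σ.length π.M))) :
    π.query ω (π.run ω σ) = π.query ω' (π.run ω' σ) := by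
  rw [π.query_run ω σ rfl, π.query_run ω' σ rfl, h, π.run_store_congr h σ,
    π.run_buffer_congr ω ω' σ]

/-- This is the freshness of the hash functions: the query reads only those of the current epoch,
which is not `e` before time `e * P`. -/
theorem epoch_ne {e : Fin (π.E + 1)} {i : ℕ} (h : i < e * π.P) :
    π.epoch (min i π.M) ≠ e := by
  intro he
  have h1 : (π.epoch (min i π.M)).1 < e := by
    refine (min_le_left _ _).trans_lt ?_
    rw [Nat.div_lt_iff_lt_mul π.P_pos]
    exact (min_le_left _ _).trans_lt h
  exact absurd (congrArg Fin.val he) h1.ne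

theorem pow_mul_card_bad_le [Fintype H] [DecidableEq H] {e : Fin (π.E + 1)}
    (huniv : ∀ u v, u ≠ v →
      π.R e * (Finset.univ.filter fun h => π.hash e h u = π.hash e h v).card ≤ Fintype.card H)
    (hN : 2 * (e * π.P) < π.R e * π.N e) {σ : List (EdgeToken n)} (hσ : σ.length = e * π.P)
    [DecidablePred (π.Bad e σ)] :
    2 ^ π.κ * (Finset.univ.filter fun x => π.Bad e σ x).card ≤ Fintype.card (Fin π.κ → H) := by
  classical
  convert pow_mul_card_filter_forall_le
    (fun h => π.N e ≤ (σ.toFinset.filter fun y => π.Mono e h y).card) ?_ π.κ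
  · rfl
  refine two_mul_card_filter_le_of_markov σ.toFinset (π.Mono e) (R := π.R e) ?_ ?_
  · rintro ⟨y, hy⟩ -
    induction y with
    | h u v =>
      refine (Nat.mul_le_mul_left _ (Finset.card_le_card ?_)).trans (huniv u v fun h => hy h)
      intro h hh
      rw [Finset.mem_filter] at hh ⊢
      exact ⟨hh.1, hh.2 u (Sym2.mem_mk_left u v) v (Sym2.mem_mk_right u v)⟩
  · have := σ.toFinset_card_le
    omega

/-- The deterministic half. By `hL` the promise is broken before the counter saturates, and `hK`
bounds the colors because the stream has already reached length `e * P`. -/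
theorem coloring_of_not_bad {L : ℕ} {K : ℕ → ℕ} (hL : n * L < 2 * (π.P * (π.E + 1)))
    (hK : ∀ (e : Fin (π.E + 1)) Δ, 2 * (e * π.P) ≤ n * Δ → π.R e * (Δ + 1) ≤ K Δ)
    (ω : π.Rand) (σ : List (EdgeToken n))
    (hbad : ∀ e : Fin (π.E + 1), e * π.P ≤ σ.length → ¬ π.Bad e (σ.take (e * π.P)) (ω e)) :
    ColoringProblem n L K σ (π.query ω (π.run ω σ)) := by
  classical
  intro hnd hΔ
  have hlen := two_mul_length_le hnd
  have hlen' : σ.length < π.P * (π.E + 1) := by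
    have := Nat.mul_le_mul_left n hΔ
    omega
  have hM : σ.length ≤ π.M := by unfold M; omega
  set e := π.epoch σ.length with he
  have heq : e.1 = σ.length / π.P := by
    have : σ.length / π.P < π.E + 1 := by
      rw [Nat.div_lt_iff_lt_mul π.P_pos, mul_comm]
      exact hlen'
    simp only [he, epoch]
    omega
  have heP : e.1 * π.P ≤ σ.length := by
    rw [heq]
    exact Nat.div_mul_le_self _ _
  -- A store contains only monochromatic edges of the prefix; if these are fewer than its capacity,
  -- it has not filled up.
  have hex : ∃ c, ((π.run ω σ).2.2 e c).1.card < π.N e := by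
    have := hbad e heP
    simp only [Bad, not_forall, not_le] at this
    obtain ⟨c, hc⟩ := this
    refine ⟨c, (Finset.card_le_card fun y hy => ?_).trans_lt hc⟩
    have := π.run_store_subset ω e c σ hM y hy
    simpa using this
  have hq : π.query ω (π.run ω σ) = fun v => π.hash e (ω e hex.choose) v + π.R e *
      greedy ((π.run ω σ).2.1.1 ∪ ((π.run ω σ).2.2 e hex.choose).1) v := by
    rw [π.query_run ω σ (min_eq_left hM)]
    funext v
    exact dif_pos hex
  rw [hq]
  have hc := hex.choose_spec
  generalize hex.choose = c at hc
  set T := (π.run ω σ).2.1.1 ∪ ((π.run ω σ).2.2 e c).1 with hT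
  have hTσ : T.toList ⊆ σ := by
    intro y hy
    rcases Finset.mem_union.1 (Finset.mem_toList.1 hy) with hy | hy
    · exact π.run_buffer_subset ω σ y hy
    · exact List.mem_of_mem_take (π.run_store_subset ω e c σ hM y hy).1
  refine ⟨fun v => ?_, fun u v huv hz => ?_⟩
  · have h1 : greedy T v ≤ streamMaxDegree σ := (greedy_le T v).trans (streamMaxDegree_mono hTσ)
    have h2 := (π.hash e (ω e c) v).2
    calc _ < π.R e + π.R e * greedy T v := Nat.add_lt_add_right h2 _
      _ = π.R e * (greedy T v + 1) := by ring
      _ ≤ π.R e * (streamMaxDegree σ + 1) := by gcongr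
      _ ≤ _ := hK e _ (by omega)
  -- The color is a number in mixed radix: its residue modulo `R e` is the hash value and its
  -- quotient the greedy color. Equal colors make the edge monochromatic, hence present in buffer or
  -- store, where the greedy coloring separates it.
  · have hmod := congrArg (· % π.R e) hz
    simp only [Nat.add_mul_mod_self_left, Nat.mod_eq_of_lt (Fin.isLt _)] at hmod
    have hhash : π.hash e (ω e c) u = π.hash e (ω e c) v := Fin.ext hmod
    have hR : 0 < π.R e := (Nat.zero_le _).trans_lt (π.hash e (ω e c) u).2
    have hg : greedy T u = greedy T v := by
      simp only [hhash] at hz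
      exact Nat.eq_of_mul_eq_mul_left hR (Nat.add_left_cancel hz)
    refine greedy_ne T ?_ hg
    obtain ⟨x, hx, hxe⟩ := streamGraph_adj.1 huv
    refine streamGraph_adj.2 ⟨x, ?_, hxe⟩
    rw [Finset.mem_toList, hT, Finset.mem_union]
    refine (π.mem_run_buffer_or ω σ hM x hx).imp_right fun hx' => ?_
    rw [← heq] at hx'
    refine π.mem_run_store ω e c σ hM hc x hx' ?_
    intro a ha b hb
    rw [hxe, Sym2.mem_iff] at ha hb
    rcases ha with rfl | rfl <;> rcases hb with rfl | rfl <;> simp [hhash]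

theorem exists_isRobust [Fintype H] [Nonempty H] [DecidableEq H] {L q s : ℕ} {K : ℕ → ℕ}
    (hL : n * L < 2 * (π.P * (π.E + 1)))
    (hK : ∀ (e : Fin (π.E + 1)) Δ, 2 * (e * π.P) ≤ n * Δ → π.R e * (Δ + 1) ≤ K Δ)
    (huniv : ∀ e u v, u ≠ v →
      π.R e * (Finset.univ.filter fun h => π.hash e h u = π.hash e h v).card ≤ Fintype.card H)
    (hN : ∀ e : Fin (π.E + 1), 2 * (e * π.P) < π.R e * π.N e)
    (hq : Fintype.card H = 2 ^ q) (hs : Fintype.card π.State ≤ 2 ^ s) :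
    ∃ A : StreamAlg (EdgeToken n) (Fin n → ℕ) s ((π.E + 1) * (π.κ * q)), ∀ m,
      A.IsRobust (ColoringProblem n L K) m ((π.E + 1 : ℕ) / 2 ^ π.κ) := by
  classical
  refine isRobust_of_fresh_epochs hs ?_ π.start π.step π.query _ (fun e => e * π.P) π.Bad ?_ ?_ ?_
  · simp only [Fintype.card_fun, Fintype.card_fin, hq, ← pow_mul]
    ring_nf
  · intro e ω x σ hσ
    exact π.query_run_congr (Function.update_of_ne (π.epoch_ne hσ) _ _)
  · intro e σ hσ
    exact π.pow_mul_card_bad_le (huniv e) (hN e) hσ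
  · exact π.coloring_of_not_bad hL hK

theorem card_state_le {l : ℕ} (hn : 1 ≤ n) (hl : n ≤ 2 ^ l) (hM : π.P * (π.E + 1) ≤ 2 ^ (3 * l + 1)) :
    Fintype.card π.State ≤ 2 ^ (3 * l + 1 + 2 * l * π.P + 2 * l * π.κ * ∑ e, π.N e) := by
  have hM' : π.M + 1 ≤ 2 ^ (3 * l + 1) := by
    have : 0 < π.P * (π.E + 1) := Nat.mul_pos π.P_pos (Nat.succ_pos π.E)
    unfold M
    omega
  have hstores : ∏ e : Fin (π.E + 1), Fintype.card (BoundedEdgeSet n (π.N e)) ^ π.κ ≤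
      2 ^ (2 * l * π.κ * ∑ e, π.N e) := by
    calc _ ≤ ∏ e : Fin (π.E + 1), 2 ^ (2 * l * π.κ * π.N e) :=
          Finset.prod_le_prod' fun e _ => by
            refine (Nat.pow_le_pow_left (BoundedEdgeSet.card_le hn hl) _).trans_eq ?_
            rw [← pow_mul]
            ring_nf
      _ = _ := by rw [Finset.prod_pow_eq_pow_sum, Finset.mul_sum]
  rw [pow_add, pow_add, mul_assoc]
  simp only [Fintype.card_prod, Fintype.card_fin, Fintype.card_pi, Finset.prod_const,
    Finset.card_univ]
  exact Nat.mul_le_mul hM' (Nat.mul_le_mul (BoundedEdgeSet.card_le hn hl) hstores)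

end EpochParams

/-! ### The choice of parameters and the space bound. -/

section Parameters

/-- The number of hash values used in epoch `e`. -/
def hashRange (a b e : ℕ) : ℕ := 2 ^ (a * Nat.log 2 (e * b))

/-- The capacity of the stores for epoch `e`. -/
def storeCapacity (n a b e : ℕ) : ℕ := 2 * (e * (n * b)) / hashRange a b e + 1

theorem hashRange_pos (a b e : ℕ) : 0 < hashRange a b e := pow_pos two_pos _

/-- The hypothesis gives `e * b ≤ Δ`, so the hash contributes at most `Δ ^ a` colors and the greedy
coloring one more factor `Δ + 1`, up to the case `Δ = 0`. -/
theorem hashRange_mul_le {n a b k e Δ : ℕ} (hn : 0 < n) (hk : a + 1 ≤ k)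
    (h : 2 * (e * (n * b)) ≤ n * Δ) : hashRange a b e * (Δ + 1) ≤ 2 * (max Δ 1) ^ k := by
  have hΔ : e * b ≤ Δ := by
    refine le_of_mul_le_mul_left ?_ hn
    calc n * (e * b) = e * (n * b) := by ring
      _ ≤ _ := by omega
  have hR : hashRange a b e ≤ max Δ 1 ^ a := by
    rw [hashRange, mul_comm a, pow_mul]
    refine Nat.pow_le_pow_left ?_ a
    rcases Nat.eq_zero_or_pos (e * b) with h0 | h0
    · simp [h0]
    · exact (Nat.pow_log_le_self 2 h0.ne').trans (hΔ.trans (le_max_left _ _))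
  calc hashRange a b e * (Δ + 1) ≤ max Δ 1 ^ a * (2 * max Δ 1) :=
        Nat.mul_le_mul hR (by omega)
    _ = 2 * max Δ 1 ^ (a + 1) := by ring
    _ ≤ _ := Nat.mul_le_mul_left _ (Nat.pow_le_pow_right (by omega) hk)

theorem lt_hashRange_mul_storeCapacity (n a b e : ℕ) :
    2 * (e * (n * b)) < hashRange a b e * storeCapacity n a b e :=
  Nat.lt_mul_div_succ _ (hashRange_pos a b e)

/-- For `a = 0` the hash has a single value, so the stores keep every edge; there are only two
epochs. -/
theorem sum_storeCapacity_zero_le {n L l : ℕ} (hn : 2 ≤ n) (hL : 1 ≤ L) (hl : 1 ≤ l) :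
    ∑ e ∈ Finset.range (L / L + 1), storeCapacity n 0 L e ≤ 20 * (n * L * l) := by
  rw [Nat.div_self hL]
  have h1 : n * L ≤ n * L * l := Nat.le_mul_of_pos_right _ hl
  have h2 : n ≤ n * L := Nat.le_mul_of_pos_right _ hL
  simp only [Finset.sum_range_succ, Finset.sum_range_zero, storeCapacity, hashRange, zero_mul,
    pow_zero, Nat.div_one, one_mul]
  omega

/-- For `a = 1` the range is at least half of `e * b`, so the factor `e` cancels and each capacity
is `O(n)`. -/
theorem storeCapacity_one_le (n b e : ℕ) : storeCapacity n 1 b e ≤ 4 * n + 1 := by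
  unfold storeCapacity
  refine Nat.add_le_add_right (Nat.div_le_of_le_mul ?_) 1
  have h : e * b ≤ 2 * hashRange 1 b e := by
    have := Nat.lt_pow_succ_log_self one_lt_two (e * b)
    rw [hashRange, one_mul]
    rw [pow_succ] at this
    omega
  nlinarith [Nat.mul_le_mul_left n h]

theorem sum_storeCapacity_one_le {n L b l : ℕ} (hn : 2 ≤ n) (hb : 1 ≤ b) (hL : L ≤ b * b)
    (hl : 1 ≤ l) :
    ∑ e ∈ Finset.range (L / b + 1), storeCapacity n 1 b e ≤ 20 * (n * b * l) := by
  have hE : L / b ≤ b := Nat.div_le_of_le_mul hL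
  have h1 : n * b ≤ n * b * l := Nat.le_mul_of_pos_right _ hl
  calc _ ≤ ∑ e ∈ Finset.range (L / b + 1), (4 * n + 1) :=
        Finset.sum_le_sum fun e _ => storeCapacity_one_le n b e
    _ = (L / b + 1) * (4 * n + 1) := by simp
    _ ≤ (2 * b) * (5 * n) := Nat.mul_le_mul (by omega) (by omega)
    _ ≤ _ := by nlinarith

theorem storeCapacity_two_le (n e : ℕ) : storeCapacity n 2 1 (e + 1) ≤ 8 * n / (e + 1) + 1 := by
  unfold storeCapacity
  refine Nat.add_le_add_right ((Nat.le_div_iff_mul_le e.succ_pos).2 ?_) 1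
  set R := hashRange 2 1 (e + 1) with hR
  have h : (e + 1) * (e + 1) ≤ 4 * R := by
    have := Nat.lt_pow_succ_log_self one_lt_two (e + 1)
    rw [pow_succ] at this
    rw [hR, hashRange, mul_one, mul_comm 2, pow_mul]
    nlinarith
  refine le_of_mul_le_mul_right ?_ e.succ_pos
  have h2 := Nat.div_mul_le_self (2 * ((e + 1) * (n * 1))) R
  calc _ = 2 * ((e + 1) * (n * 1)) / R * ((e + 1) * (e + 1)) := by
        rw [Nat.succ_eq_add_one]; ring
    _ ≤ 2 * ((e + 1) * (n * 1)) / R * (4 * R) := Nat.mul_le_mul_left _ h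
    _ = 4 * (2 * ((e + 1) * (n * 1)) / R * R) := by ring
    _ ≤ 4 * (2 * ((e + 1) * (n * 1))) := Nat.mul_le_mul_left _ h2
    _ = _ := by rw [Nat.succ_eq_add_one]; ring

/-- For `a = 2` and `b = 1` the capacities decay like `n / e`, and the harmonic sum costs one factor
`log L ≤ l`. -/
theorem sum_storeCapacity_two_le {n L l : ℕ} (hn : 2 ≤ n) (hL : 1 ≤ L) (hLn : L ≤ n)
    (hl : 1 ≤ l) (hnl : n ≤ 2 ^ l) :
    ∑ e ∈ Finset.range (L / 1 + 1), storeCapacity n 2 1 e ≤ 20 * (n * 1 * l) := by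
  have h0 : storeCapacity n 2 1 0 = 1 := by simp [storeCapacity]
  have hlog : Real.log L ≤ l := by
    have h1 : Real.log L ≤ Real.log (2 ^ l) :=
      Real.log_le_log (by exact_mod_cast hL) (by exact_mod_cast hLn.trans hnl)
    rw [Real.log_pow] at h1
    have := Real.log_two_lt_d9
    have hl0 : (0 : ℝ) ≤ l := Nat.cast_nonneg l
    nlinarith
  have hharm : ∑ e ∈ Finset.range L, 8 * n / (e + 1) ≤ 16 * (n * l) := by
    have h1 := harmonic_le_one_add_log L
    have h2 : ((∑ e ∈ Finset.range L, 8 * n / (e + 1) : ℕ) : ℝ) ≤ 8 * n * (harmonic L : ℝ) := by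
      rw [harmonic]
      push_cast
      rw [Finset.mul_sum]
      refine Finset.sum_le_sum fun e _ => ?_
      refine Nat.cast_div_le.trans_eq ?_
      push_cast
      rw [div_eq_mul_inv]
    have hl1 : (1 : ℝ) ≤ l := by exact_mod_cast hl
    have hn0 : (0 : ℝ) ≤ n := Nat.cast_nonneg n
    have h3 : ((∑ e ∈ Finset.range L, 8 * n / (e + 1) : ℕ) : ℝ) ≤ (16 * (n * l) : ℕ) := by
      push_cast at h2 ⊢
      nlinarith [mul_le_mul_of_nonneg_left (h1.trans (by linarith : 1 + Real.log L ≤ 2 * l)) hn0]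
    exact_mod_cast h3
  have h1 : n ≤ n * l := Nat.le_mul_of_pos_right _ hl
  rw [Nat.div_one, Finset.sum_range_succ', h0]
  have h2 : ∑ e ∈ Finset.range L, storeCapacity n 2 1 (e + 1) ≤
      ∑ e ∈ Finset.range L, (8 * n / (e + 1) + 1) :=
    Finset.sum_le_sum fun e _ => storeCapacity_two_le n e
  rw [Finset.sum_add_distrib, Finset.sum_const, Finset.card_range, smul_eq_mul] at h2
  rw [mul_one]
  omega

theorem StreamAlg.IsRobust.mono {U Z : Type} {s r : ℕ} {A : StreamAlg U Z s r}
    {f g : List U → Z → Prop} {m : ℕ} {δ ε : ℝ} (h : A.IsRobust f m δ)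
    (hfg : ∀ σ z, f σ z → g σ z) (hδ : δ ≤ ε) : A.IsRobust g m ε := by
  intro next
  refine (sub_le_sub_left hδ 1).trans ((h next).trans ?_)
  unfold bitProb
  refine div_le_div_of_nonneg_right ?_ (by positivity)
  refine Nat.cast_le.2 (Nat.card_le_card_of_injective
    (Subtype.map id fun R hR i hi => hfg _ _ (hR i hi)) ?_)
  exact Subtype.map_injective _ Function.injective_id

theorem exists_robust_coloring {n L a b k l : ℕ} (p : ℕ) (hn : 2 ≤ n) (hLn : L ≤ n)
    (hb : 1 ≤ b) (hbL : b ≤ 2 * L) (ha : a ≤ 2) (hk : a + 1 ≤ k) (hl : l = Nat.log 2 n + 1)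
    (hsum : ∑ e ∈ Finset.range (L / b + 1), storeCapacity n a b e ≤ 20 * (n * b * l)) :
    ∃ (s r : ℕ) (A : StreamAlg (EdgeToken n) (Fin n → ℕ) s r),
      s + r ≤ (44 * p + 94) * (n * b * l ^ 3) ∧
      ∀ m, A.IsRobust (ColoringProblem n L fun Δ => 2 * (max Δ 1) ^ k) m (1 / (n : ℝ) ^ p) := by
  have hnl : n ≤ 2 ^ l := by
    rw [hl]
    exact (Nat.lt_pow_succ_log_self one_lt_two n).le
  have hl2 : 2 ≤ l := by
    have := Nat.log_pos one_lt_two hn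
    omega
  have hE : L / b ≤ L := Nat.div_le_self _ _
  have hρ : ∀ e : Fin (L / b + 1), a * Nat.log 2 (e * b) ≤ 2 * l := by
    intro e
    have h1 : e * b ≤ n :=
      ((Nat.mul_le_mul_right b (Nat.lt_succ_iff.1 e.2)).trans (Nat.div_mul_le_self L b)).trans hLn
    have h2 : Nat.log 2 (e * b) ≤ l := by
      have := Nat.log_mono_right (b := 2) h1
      omega
    exact Nat.mul_le_mul ha h2
  have hhash := fun e : Fin (L / b + 1) =>
    exists_universal_hash (V := Fin n) (t := l) (by simpa using hnl) (hρ e)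
  choose hash huniv using hhash
  -- The exponent of each range is at most `2 * l`, so `2 * l` rows suffice for all epochs. The
  -- value of `κ` gives `2 ^ κ ≥ n ^ (p + 2)`: one factor `n ^ 2` pays for the union bound over
  -- epochs, the rest is the required error.
  let π : EpochParams n (Fin (2 * l) → Fin l → ZMod 2) :=
    { P := n * b
      E := L / b
      κ := (p + 2) * l
      N := fun e => storeCapacity n a b e
      R := fun e => hashRange a b e
      hash := hash
      P_pos := Nat.mul_pos (by omega) hb }
  have hsum' : ∑ e, π.N e ≤ 20 * (n * b * l) := by
    rw [← Fin.sum_univ_eq_sum_range] at hsum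
    exact hsum
  have hPE : n * b * (L / b + 1) ≤ 3 * (n * n) := by
    have h1 : b * (L / b) ≤ L := Nat.mul_div_le L b
    have h2 : b * (L / b + 1) ≤ 3 * n := by
      rw [mul_add]
      omega
    calc _ = n * (b * (L / b + 1)) := by ring
      _ ≤ n * (3 * n) := Nat.mul_le_mul_left _ h2
      _ = _ := by ring
  have hcard := π.card_state_le (l := l) (by omega) hnl (by
    refine hPE.trans ?_
    calc 3 * (n * n) ≤ 2 ^ l * (2 ^ l * 2 ^ l) := by
          refine Nat.mul_le_mul ?_ (Nat.mul_le_mul hnl hnl)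
          have : 2 ^ 2 ≤ 2 ^ l := Nat.pow_le_pow_right two_pos hl2
          omega
      _ = 2 ^ (3 * l) := by ring
      _ ≤ _ := Nat.pow_le_pow_right two_pos (by omega))
  have hL : n * L < 2 * (n * b * (L / b + 1)) := by
    calc n * L < n * (b * (L / b + 1)) :=
          Nat.mul_lt_mul_of_pos_left (Nat.lt_mul_div_succ L hb) (by omega)
      _ ≤ 2 * (n * b * (L / b + 1)) := by rw [mul_assoc]; omega
  obtain ⟨A, hA⟩ := π.exists_isRobust (q := l * (2 * l)) (K := fun Δ => 2 * (max Δ 1) ^ k) hL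
    (fun e Δ h => hashRange_mul_le (by omega) hk h) huniv
    (fun e => lt_hashRange_mul_storeCapacity n a b e) (by simp [ZMod.card, ← pow_mul]) hcard
  refine ⟨_, _, A, ?_, fun m => (hA m).mono (fun _ _ h => h) ?_⟩
  · have hX : 1 ≤ n * b := Nat.mul_pos (by omega) hb
    have hE1 : L / b + 1 ≤ 2 * (n * b) := by nlinarith
    have h1 : 2 * l * ((p + 2) * l) * ∑ e, π.N e ≤
        2 * l * ((p + 2) * l) * (20 * (n * b * l)) := Nat.mul_le_mul_left _ hsum'
    have h2 : (L / b + 1) * ((p + 2) * l * (l * (2 * l))) ≤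
        2 * (n * b) * ((p + 2) * l * (l * (2 * l))) := Nat.mul_le_mul_right _ hE1
    have h3 : l ≤ l ^ 3 := Nat.le_self_pow (by norm_num) l
    have h4 : n * b * l ≤ n * b * l ^ 3 := Nat.mul_le_mul_left _ h3
    have h5 : l ≤ n * b * l := Nat.le_mul_of_pos_left _ hX
    calc _ = 3 * l + 1 + 2 * l * (n * b) + 2 * l * ((p + 2) * l) * ∑ e, π.N e +
          (L / b + 1) * ((p + 2) * l * (l * (2 * l))) := rfl
      _ ≤ 4 * (n * b * l ^ 3) + 2 * (n * b * l ^ 3) +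
          2 * l * ((p + 2) * l) * (20 * (n * b * l)) +
          2 * (n * b) * ((p + 2) * l * (l * (2 * l))) := by
          have h6 : 2 * l * (n * b) = 2 * (n * b * l) := by ring
          omega
      _ = _ := by ring
  · have hnp : (0 : ℝ) < (n : ℝ) ^ p := by positivity
    rw [div_le_div_iff₀ (by positivity) hnp, one_mul]
    have h : (L / b + 1) * n ^ p ≤ 2 ^ ((p + 2) * l) := by
      calc (L / b + 1) * n ^ p ≤ (n * n) * n ^ p := Nat.mul_le_mul_right _ (by nlinarith)
        _ = n ^ (p + 2) := by ring
        _ ≤ (2 ^ l) ^ (p + 2) := Nat.pow_le_pow_left hnl _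
        _ = _ := by rw [← pow_mul, mul_comm]
    exact_mod_cast h

theorem natLog_two_succ_le {n : ℕ} (hn : 2 ≤ n) : ((Nat.log 2 n + 1 : ℕ) : ℝ) ≤ 3 * Real.log n := by
  have h1 : Real.log 2 ≤ Real.log n := Real.log_le_log two_pos (by exact_mod_cast hn)
  have h2 : Nat.log 2 n * Real.log 2 ≤ Real.log n := by
    rw [← Real.log_pow]
    exact Real.log_le_log (by positivity) (by exact_mod_cast Nat.pow_log_le_self 2 (by omega))
  have h3 := Real.log_two_gt_d9
  have h4 : (0 : ℝ) ≤ Nat.log 2 n := Nat.cast_nonneg _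
  push_cast
  nlinarith

/-- The buffer parameter: `b ≈ L ^ (1 / k)` for `k ≤ 2`, and `b = 1` for `k ≥ 3`. -/
theorem exists_buffer_parameter {n k L l : ℕ} (hn : 2 ≤ n) (hk : 1 ≤ k) (hL : 1 ≤ L)
    (hLn : L ≤ n) (hl : 1 ≤ l) (hnl : n ≤ 2 ^ l) :
    ∃ a b : ℕ, a ≤ 2 ∧ a + 1 ≤ k ∧ 1 ≤ b ∧ b ≤ 2 * L ∧
      (b : ℝ) ≤ 2 * (L : ℝ) ^ (1 / (k : ℝ)) ∧
      ∑ e ∈ Finset.range (L / b + 1), storeCapacity n a b e ≤ 20 * (n * b * l) := by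
  have hL' : (1 : ℝ) ≤ L := by exact_mod_cast hL
  obtain rfl | rfl | hk3 : k = 1 ∨ k = 2 ∨ 3 ≤ k := by omega
  · refine ⟨0, L, by norm_num, by norm_num, hL, by omega, ?_, sum_storeCapacity_zero_le hn hL hl⟩
    rw [Nat.cast_one, div_one, Real.rpow_one]
    linarith
  -- Rounding the square root up ensures `L ≤ b * b`, so that there are at most `b + 1` epochs.
  · refine ⟨1, Nat.sqrt L + 1, by norm_num, by norm_num, by omega, ?_, ?_,
      sum_storeCapacity_one_le hn (by omega) (Nat.lt_succ_sqrt L).le hl⟩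
    · have := Nat.sqrt_le_self L
      omega
    · rw [Nat.cast_ofNat, ← Real.sqrt_eq_rpow]
      have h1 := Real.nat_sqrt_le_real_sqrt (a := L)
      have h2 := Real.one_le_sqrt.2 hL'
      push_cast
      linarith
  · refine ⟨2, 1, le_rfl, hk3, le_rfl, by omega, ?_, sum_storeCapacity_two_le hn hL hLn hl hnl⟩
    have := Real.one_le_rpow hL' (show 0 ≤ 1 / (k : ℝ) by positivity)
    push_cast
    linarith

end Parameters

/-! ### The main theorem. -/

theorem mainTheorem8 :
    ∃ C : ℕ, ∀ p : ℕ, ∃ (B : ℝ) (c : ℕ),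
      ∀ n k L : ℕ, 2 ≤ n → 1 ≤ k → 1 ≤ L →
        ∃ (s r : ℕ) (A : StreamAlg (EdgeToken n) (Fin n → ℕ) s r),
          (s : ℝ) + (r : ℝ) ≤ B * n * (L : ℝ) ^ (1 / (k : ℝ)) * Real.log n ^ c ∧
          ∀ m : ℕ, A.IsRobust (ColoringProblem n L fun Δ => C * (max Δ 1) ^ k) m
            (1 / (n : ℝ) ^ p) := by
  -- The factor `54 = 2 * 3 ^ 3` comes from `b ≤ 2 * L ^ (1 / k)` and from replacing the binary
  -- logarithm by `3 * Real.log n` in a cube.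
  refine ⟨2, fun p => ⟨(44 * p + 94) * 54, 3, fun n k L hn hk hL => ?_⟩⟩
  have hnl := (Nat.lt_pow_succ_log_self one_lt_two n).le
  obtain ⟨a, b, ha, hak, hb, hbL, hbr, hsum⟩ := exists_buffer_parameter (L := min L n) hn hk
    (by omega) (min_le_right _ _) (by omega) hnl
  obtain ⟨s, r, A, hsr, hA⟩ := exists_robust_coloring p hn (min_le_right L n) hb hbL ha hak rfl hsum
  refine ⟨s, r, A, ?_, fun m => (hA m).mono (fun _ _ h => h.of_min (by omega)) le_rfl⟩
  have hlog := natLog_two_succ_le hn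
  have hbr' : (b : ℝ) ≤ 2 * (L : ℝ) ^ (1 / (k : ℝ)) := by
    refine hbr.trans (mul_le_mul_of_nonneg_left ?_ zero_le_two)
    exact Real.rpow_le_rpow (Nat.cast_nonneg _) (by exact_mod_cast min_le_left L n) (by positivity)
  calc (s : ℝ) + r ≤ ((44 * p + 94) * (n * b * (Nat.log 2 n + 1) ^ 3) : ℕ) := by
        exact_mod_cast hsr
    _ = (44 * p + 94) * (n * b * ((Nat.log 2 n + 1 : ℕ) : ℝ) ^ 3) := by push_cast; ring
    _ ≤ (44 * p + 94) * (n * (2 * (L : ℝ) ^ (1 / (k : ℝ))) * (3 * Real.log n) ^ 3) := by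
        gcongr
    _ = _ := by ring
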